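/- Let $X$ and $Z$ be real Hausdorff locally convex topological vector spaces. Let $C\subseteq Z$ be a convex, pointed cone, i.e. $tc\in C$ for all $c\in C$, $t\ge 0$, $C+C=C$ and $C\cap(-C)=\{0\}$. Let $K\subseteq X$ be nonempty, convex and closed, and let $D\subseteq K$ be self segment-dense in $K$, i.e. $D$ is dense in $K$ and, for all $x,y\in D$, the set $[x,y]\cap D$ is dense in the closed segment $[x,y]$. A map $g:K\to Z$ is called strongly $C$-upper semicontinuous at $x\in K$ if for every $k\in C\setminus\{0\}$ there is a neighbourhood $U$ of $x$ such that $g(u)\in g(x)+k-(C\setminus\{0\})$ for all $u\in U\cap K$; and strongly $C$-upper semicontinuous on a subset of $K$ if it is so at each point of that subset. A map $g:K\to Z$ is called $C$-convex on $D$ if $\sum_{i=1}^n\lambda_i g(x_i)-g\left(\sum_{i=1}^n\lambda_i x_i\right)\in C$ for all $n\ge 1$, $x_1,\dots,x_n\in D$ and $\lambda_1,\dots,\lambda_n\ge 0$ with $\sum_{i=1}^n\lambda_i=1$ and $\sum_{i=1}^n\lambda_i x_i\in D$. Let $f:K\times K\to Z$ satisfy: (i) for every $y\in D$, the map $x\mapsto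 f(x,y)$ is strongly $C$-upper semicontinuous on $K$; (ii) for every $x\in K$, the map $y\mapsto f(x,y)$ is strongly $C$-upper semicontinuous on $K\setminus D$; (iii) for every $x\in D$, the map $y\mapsto f(x,y)$ is $C$-convex on $D$; (iv) $f(x,x)\notin -C\setminus\{0\}$ for every $x\in D$; (v) there exist a compact set $K_0\subseteq X$ and a point $y_0\in D$ such that $f(x,y_0)\in -C\setminus\{0\}$ for all $x\in K\setminus K_0$. Then there exists $x_0\in K$ such that $f(x_0,y)\notin -C\setminus\{0\}$ for all $y\in K$. -/

import Mathlib

open Set Topology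
open scoped Pointwise

/-- `U` is self segment-dense in the (convex) set `V`: `U ⊆ V`, `U` is dense in `V`, and for all
`x, y ∈ U` the set `[x, y] ∩ U` is dense in the closed segment `[x, y]`. -/
def SelfSegmentDense {X : Type*} [AddCommGroup X] [Module ℝ X] [TopologicalSpace X]
    (U V : Set X) : Prop :=
  U ⊆ V ∧ V ⊆ closure U ∧
    ∀ x ∈ U, ∀ y ∈ U, segment ℝ x y ⊆ closure (segment ℝ x y ∩ U)

/-- The map `g : K → Z` is strongly `C`-upper semicontinuous at `x`: for every `k ∈ C \ {0}` there
is a neighbourhood `U` of `x` such that `g u ∈ g x + k - (C \ {0})` for all `u ∈ U ∩ K`.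
(Only the values of `g` on `K` matter when `x ∈ K`.) -/
def StronglyUpperSemicontinuousAt {X Z : Type*} [TopologicalSpace X] [AddCommGroup Z] [Module ℝ Z]
    (C : PointedCone ℝ Z) (K : Set X) (g : X → Z) (x : X) : Prop :=
  ∀ k ∈ (C : Set Z) \ {0}, ∃ U ∈ 𝓝 x, ∀ u ∈ U ∩ K, g u ∈ {g x + k} - ((C : Set Z) \ {0})

/-- `g` is `C`-convex on the (not necessarily convex) set `S`: for all convex combinations of
points of `S` which lie in `S` one has `g (∑ λᵢ xᵢ) ≤ ∑ λᵢ g (xᵢ)`, where `z₁ ≤ z₂` means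
`z₂ - z₁ ∈ C`. -/
def ConeConvexOn {X Z : Type*} [AddCommGroup X] [Module ℝ X] [AddCommGroup Z] [Module ℝ Z]
    (C : PointedCone ℝ Z) (S : Set X) (g : X → Z) : Prop :=
  ∀ (n : ℕ) (x : Fin n → X) (w : Fin n → ℝ), (∀ i, x i ∈ S) → (∀ i, 0 ≤ w i) →
    ∑ i, w i = 1 → ∑ i, w i • x i ∈ S →
      ∑ i, w i • g (x i) - g (∑ i, w i • x i) ∈ C

/-! Let `G y` be the set of `x ∈ K` with `f x y ∉ -C \ {0}`. A solution is a point lying in every `G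
y`. For `y ∈ D`, strong upper semicontinuity in the first variable makes `G y` closed, and
coercivity puts `G y₀` inside a compact set. If a point `x ∈ D` of a polytope spanned by points of
`D` avoided every `G y` at its vertices, `C`-convexity would give `f x x ∈ -C \ {0}`, contrary to
`h₄`. Self segment-density makes such `x` dense in the polytope, so the closed sets `G y` cover all
of it. Fan–KKM and compactness then give `x₀` in every `G y` with `y ∈ D`, and semicontinuity in the
second variable extends this to `y ∈ K \ D`.

KKM is derived from Brouwer's theorem, and Brouwer from Scarf's lemma by a parity count of
dominating sets, with grid points of the simplex ranked by their coordinates. -/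

/-! ### Dominating sets and Scarf's lemma. -/

/-- Given rankings `r i` of `V`, a finset `S` is dominating when every point of `V` lies, for some
ranking, below all points of `S`. -/
def IsDominating {ι V : Type*} (r : ι → V → ℕ) (S : Finset V) : Prop :=
  ∀ y, ∃ i, ∀ x ∈ S, r i y ≤ r i x

namespace IsDominating

variable {ι V : Type*} {r : ι → V → ℕ} {S : Finset V}

lemma mono {S' : Finset V} (h : IsDominating r S) (hS : S' ⊆ S) : IsDominating r S' :=
  fun y ↦ (h y).imp fun _ hi x hx ↦ hi x (hS hx)

/-- Domination applied to `x` itself makes `x` minimal on `S` for some ranking. -/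
lemma exists_eq_of_argmin (h : IsDominating r S) (hr : ∀ i, Function.Injective (r i))
    {m : ι → V} (hmS : ∀ i, m i ∈ S) (hm : ∀ i, ∀ x ∈ S, r i (m i) ≤ r i x) {x : V}
    (hx : x ∈ S) : ∃ i, m i = x := by
  obtain ⟨i, hi⟩ := h x
  exact ⟨i, hr i ((hm i x hx).antisymm (hi _ (hmS i)))⟩

/-- A dominating set with one point fewer than there are rankings extends to a dominating set by
exactly two points, as soon as the two relevant regions are nonempty. -/
lemma card_filter_insert [Fintype ι] [DecidableEq V] [Fintype V]
    (h : IsDominating r S) (hr : ∀ i, Function.Injective (r i)) (hne : S.Nonempty)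
    (hcard : S.card + 1 = Fintype.card ι)
    (hout : ∀ k, ∃ v, ∀ l ≠ k, ∃ x ∈ S, r l x < r l v)
    [DecidablePred fun x ↦ x ∉ S ∧ IsDominating r (insert x S)] :
    (Finset.univ.filter fun x ↦ x ∉ S ∧ IsDominating r (insert x S)).card = 2 := by
  classical
  choose m hmS hm using fun i ↦ S.exists_min_image (r i) hne
  have hsurj : ∀ x ∈ S, ∃ i, m i = x := fun x hx ↦ h.exists_eq_of_argmin hr hmS hm hx
  obtain ⟨i, -, j, -, hij, hmij⟩ : ∃ i ∈ Finset.univ, ∃ j ∈ Finset.univ, i ≠ j ∧ m i = m j := by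
    refine Finset.exists_ne_map_eq_of_card_lt_of_maps_to (t := S) ?_ fun i _ ↦ hmS i
    rw [Finset.card_univ]; lia
  have hsurj' : ∀ k, (k = i ∨ k = j) → ∀ x ∈ S, ∃ l ≠ k, m l = x := by
    intro k hk x hx
    obtain ⟨l, rfl⟩ := hsurj x hx
    by_cases hlk : l = k
    · rcases hk with rfl | rfl
      · exact ⟨j, hij.symm, by rw [hlk, hmij]⟩
      · exact ⟨i, hij, by rw [hlk, hmij]⟩
    · exact ⟨l, hlk, rfl⟩
  -- the region of type `k` and its best point
  set M : ι → Finset V := fun k ↦ Finset.univ.filter fun y ↦ ∀ l ≠ k, r l (m l) < r l y with hMdef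
  have hMmem : ∀ k y, y ∈ M k ↔ ∀ l ≠ k, r l (m l) < r l y := by simp [hMdef]
  have hMne : ∀ k, (M k).Nonempty := by
    intro k
    obtain ⟨v, hv⟩ := hout k
    refine ⟨v, (hMmem k v).2 fun l hl ↦ ?_⟩
    obtain ⟨x, hx, hlt⟩ := hv l hl
    exact (hm l x hx).trans_lt hlt
  choose t htM ht using fun k ↦ (M k).exists_max_image (r k) (hMne k)
  -- For `y ∈ M k`, every ranking other than `k` fails to witness domination of `y`.
  have hMle : ∀ k, ∀ y ∈ M k, ∀ x ∈ S, r k y ≤ r k x := by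
    intro k y hy x hx
    obtain ⟨l, hl⟩ := h y
    by_cases hlk : l = k
    · exact hlk ▸ hl x (by assumption)
    · exact absurd (hl _ (hmS l)) ((hMmem k y).1 hy l hlk).not_ge
  have hne' : t i ≠ t j := by
    intro he
    have h1 := (hMmem i _).1 (htM i) j hij.symm
    have h2 := hMle j _ (htM j) _ (hmS j)
    rw [he] at h1
    exact absurd h2 h1.not_ge
  have key : (Finset.univ.filter fun x ↦ x ∉ S ∧ IsDominating r (insert x S)) = {t i, t j} := by
    ext x
    simp only [Finset.mem_filter, Finset.mem_univ, true_and, Finset.mem_insert,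
      Finset.mem_singleton]
    constructor
    · rintro ⟨hxS, hdom⟩
      -- There are now as many points as rankings, so the minimiser map `m'` is bijective. It agrees
      -- with `m` away from the ranking `a` minimised by `x`, so `a` must be one of the colliding
      -- indices `i`, `j`.
      choose m' hm'S hm' using fun i ↦ (insert x S).exists_min_image (r i) (by simp)
      have hs' : ∀ y ∈ insert x S, ∃ i, m' i = y :=
        fun y hy ↦ hdom.exists_eq_of_argmin hr hm'S hm' hy
      have hinj : Function.Injective m' := by
        have himg : Finset.univ.image m' = insert x S := by
          ext y
          simp only [Finset.mem_image, Finset.mem_univ, true_and]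
          exact ⟨by rintro ⟨l, rfl⟩; exact hm'S l, hs' y⟩
        rw [← Set.injOn_univ, ← Finset.coe_univ, ← Finset.card_image_iff, himg,
          Finset.card_insert_of_notMem hxS, hcard, Finset.card_univ]
      obtain ⟨a, ha⟩ := hs' x (by simp)
      have hm'm : ∀ l ≠ a, m' l = m l := by
        intro l hl
        have hlS : m' l ∈ S := by
          rcases Finset.mem_insert.1 (hm'S l) with he | he
          · exact absurd (hinj (he.trans ha.symm)) hl
          · exact he
        exact hr l ((hm' l _ (Finset.mem_insert_of_mem (hmS l))).antisymm (hm l _ hlS))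
      have haij : a = i ∨ a = j := by
        by_contra! hcon
        refine hij (hinj ?_)
        rw [hm'm i hcon.1.symm, hm'm j hcon.2.symm, hmij]
      have hxM : x ∈ M a := by
        refine (hMmem a x).2 fun l hl ↦ lt_of_le_of_ne ?_ ?_
        · rw [← hm'm l hl]
          exact hm' l x (by simp)
        · intro he
          exact hxS (hr l he ▸ hmS l)
      have hxt : x = t a := by
        refine hr a (le_antisymm (ht a x hxM) ?_)
        obtain ⟨l, hl⟩ := hdom (t a)
        by_cases hla : l = a
        · exact hla ▸ hl x (by simp)
        · exact absurd (hl _ (Finset.mem_insert_of_mem (hmS l)))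
            ((hMmem a _).1 (htM a) l hla).not_ge
      rcases haij with rfl | rfl
      · exact Or.inl hxt
      · exact Or.inr hxt
    · intro hx
      obtain ⟨k, hk, rfl⟩ : ∃ k, (k = i ∨ k = j) ∧ x = t k := by
        rcases hx with rfl | rfl
        · exact ⟨i, Or.inl rfl, rfl⟩
        · exact ⟨j, Or.inr rfl, rfl⟩
      refine ⟨fun hS ↦ ?_, fun y ↦ ?_⟩
      · obtain ⟨l, hl, he⟩ := hsurj' k hk _ hS
        have := (hMmem k _).1 (htM k) l hl
        rw [he] at this
        exact lt_irrefl _ this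
      · by_cases hy : y ∈ M k
        · refine ⟨k, fun x hx ↦ ?_⟩
          rcases Finset.mem_insert.1 hx with rfl | hx
          · exact ht k y hy
          · exact hMle k y hy x hx
        · rw [hMmem] at hy
          push Not at hy
          obtain ⟨l, hl, hyl⟩ := hy
          refine ⟨l, fun x hx ↦ ?_⟩
          rcases Finset.mem_insert.1 hx with rfl | hx
          · exact hyl.trans ((hMmem k _).1 (htM k) l hl).le
          · exact hyl.trans (hm l x hx)
  rw [key, Finset.card_pair hne']

end IsDominating

/-- If a colouring of a set with as many points as colours misses a colour, then an even number of
its facets carry exactly the colours different from a given one. -/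
lemma even_card_filter_image_erase {ι V : Type*} [Fintype ι] [DecidableEq ι] [DecidableEq V]
    (c : V → ι) (i₀ : ι) {S : Finset V} (hcard : S.card = Fintype.card ι)
    (hS : S.image c ≠ Finset.univ) :
    Even (S.filter fun x ↦ (S.erase x).image c = Finset.univ.erase i₀).card := by
  rcases (S.filter fun x ↦ (S.erase x).image c = Finset.univ.erase i₀).eq_empty_or_nonempty
    with he | ⟨x, hx⟩
  · simp [he]
  obtain ⟨hxS, hx⟩ := Finset.mem_filter.1 hx
  have hinj : Set.InjOn c (S.erase x) := by
    rw [← Finset.card_image_iff, hx, Finset.card_erase_of_mem hxS,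
      Finset.card_erase_of_mem (Finset.mem_univ _), hcard, Finset.card_univ]
  have himg : S.image c = insert (c x) (Finset.univ.erase i₀) := by
    rw [← hx, ← Finset.image_insert, Finset.insert_erase hxS]
  have hcx : c x ≠ i₀ := by
    intro h
    rw [h, Finset.insert_erase (Finset.mem_univ _)] at himg
    exact hS himg
  -- The colour of `x` occurs exactly once more, at `y`; only deleting `x` or `y` leaves all colours
  -- distinct.
  obtain ⟨y, hyS, hy⟩ : ∃ y ∈ S.erase x, c y = c x := by
    rw [← Finset.mem_image, hx]
    simp [hcx]
  have hyx : y ≠ x := Finset.ne_of_mem_erase hyS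
  have : (S.filter fun x ↦ (S.erase x).image c = Finset.univ.erase i₀) = {x, y} := by
    ext z
    simp only [Finset.mem_filter, Finset.mem_insert, Finset.mem_singleton]
    constructor
    · rintro ⟨hzS, hz⟩
      by_contra! hcon
      have hcz : c z ∈ (S.erase z).image c := by
        rw [hz, ← hx]
        exact Finset.mem_image_of_mem _ (by simp [hcon.1, hzS])
      obtain ⟨w, hw, hwz⟩ := Finset.mem_image.1 hcz
      obtain ⟨hwz', hwS⟩ := Finset.mem_erase.1 hw
      by_cases hwx : w = x
      · subst hwx
        exact hcon.2 (hinj (by simp [hcon.1, hzS]) hyS (by rw [hy, hwz]))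
      · exact hwz' (hinj (by simp [hwx, hwS]) (by simp [hcon.1, hzS]) hwz)
    · rintro (rfl | rfl)
      · exact ⟨hxS, hx⟩
      · refine ⟨Finset.mem_of_mem_erase hyS, ?_⟩
        rw [← hx]
        ext a
        simp only [Finset.mem_image, Finset.mem_erase]
        constructor
        · rintro ⟨b, ⟨hb, hbS⟩, rfl⟩
          by_cases hbx : b = x
          · exact ⟨z, ⟨hyx, Finset.mem_of_mem_erase hyS⟩, by rw [hbx, hy]⟩
          · exact ⟨b, ⟨hbx, hbS⟩, rfl⟩
        · rintro ⟨b, ⟨hb, hbS⟩, rfl⟩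
          by_cases hbx : b = z
          · exact ⟨x, ⟨hyx.symm, hxS⟩, by rw [hbx, hy]⟩
          · exact ⟨b, ⟨hbx, hbS⟩, rfl⟩
  rw [this, Finset.card_pair hyx.symm]
  exact even_two

/-- **Scarf's lemma**: for rankings of `T` together with one slack element per ranking, every
colouring giving each slack element its own colour admits a rainbow dominating set. -/
theorem exists_isDominating_image_eq_univ {ι T : Type*} [Fintype ι] [DecidableEq ι] [Nonempty ι]
    [Fintype T] [Nonempty T] [DecidableEq T] (r : ι → T ⊕ ι → ℕ)
    (hr : ∀ i, Function.Injective (r i)) (hslack : ∀ i v, r i (.inr i) ≤ r i v)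
    (hlt : ∀ i j, j ≠ i → ∀ t, r i (.inl t) < r i (.inr j))
    (c : T ⊕ ι → ι) (hc : ∀ i, c (.inr i) = i) :
    ∃ S : Finset (T ⊕ ι), S.card = Fintype.card ι ∧ IsDominating r S ∧
      S.image c = Finset.univ := by
  classical
  by_contra! hcon
  obtain ⟨i₀⟩ := ‹Nonempty ι›
  -- Rooms `R` and doors `P`: without a rainbow room, each room has an even number of doors. Each
  -- door lies in two rooms, except one outer door lying in a single room, so the incidence count is
  -- both even and odd.
  set R : Finset (Finset (T ⊕ ι)) :=
    Finset.univ.filter fun S ↦ S.card = Fintype.card ι ∧ IsDominating r S with hR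
  set P : Finset (Finset (T ⊕ ι)) :=
    Finset.univ.filter fun S ↦ S.card + 1 = Fintype.card ι ∧ IsDominating r S ∧
      S.image c = Finset.univ.erase i₀ with hP
  have hcount := Finset.sum_card_bipartiteAbove_eq_sum_card_bipartiteBelow
    (s := P) (t := R) (fun S' S ↦ S' ⊆ S)
  have hroom : ∀ S ∈ R, Even (P.bipartiteBelow (fun S' S ↦ S' ⊆ S) S).card := by
    intro S hS
    obtain ⟨hSc, hSd⟩ := (Finset.mem_filter.1 hS).2
    have : P.bipartiteBelow (fun S' S ↦ S' ⊆ S) S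
        = (S.filter fun x ↦ (S.erase x).image c = Finset.univ.erase i₀).image S.erase := by
      ext S'
      simp only [Finset.mem_bipartiteBelow, hP, Finset.mem_filter, Finset.mem_univ, true_and,
        Finset.mem_image]
      constructor
      · rintro ⟨⟨h1, -, h3⟩, hsub⟩
        obtain ⟨x, hx, rfl⟩ := (Finset.covBy_iff_card_sdiff_eq_one.2
          ⟨hsub, by rw [Finset.card_sdiff_of_subset hsub]; lia⟩).exists_finset_erase
        exact ⟨x, ⟨hx, h3⟩, rfl⟩
      · rintro ⟨x, ⟨hx, h⟩, rfl⟩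
        refine ⟨⟨?_, hSd.mono (Finset.erase_subset _ _), h⟩, Finset.erase_subset _ _⟩
        rw [Finset.card_erase_add_one hx, hSc]
    rw [this, Finset.card_image_of_injOn]
    · exact even_card_filter_image_erase c i₀ hSc (hcon S hSc hSd)
    · exact (Finset.erase_injOn S).mono (Finset.coe_subset.2 (Finset.filter_subset _ _))
  have hdoor : ∀ S' ∈ P, (R.bipartiteAbove (fun S' S ↦ S' ⊆ S) S').card =
      (Finset.univ.filter fun x ↦ x ∉ S' ∧ IsDominating r (insert x S')).card := by
    intro S' hS'
    obtain ⟨h1, -, -⟩ := (Finset.mem_filter.1 hS').2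
    have : R.bipartiteAbove (fun S' S ↦ S' ⊆ S) S' = (Finset.univ.filter fun x ↦
        x ∉ S' ∧ IsDominating r (insert x S')).image fun x ↦ insert x S' := by
      ext S
      simp only [Finset.mem_bipartiteAbove, hR, Finset.mem_filter, Finset.mem_univ, true_and,
        Finset.mem_image]
      constructor
      · rintro ⟨⟨h2, h3⟩, hsub⟩
        obtain ⟨x, hx, rfl⟩ := (Finset.covBy_iff_card_sdiff_eq_one.2
          ⟨hsub, by rw [Finset.card_sdiff_of_subset hsub]; lia⟩).exists_finset_insert
        exact ⟨x, ⟨hx, h3⟩, rfl⟩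
      · rintro ⟨x, ⟨hx, h⟩, rfl⟩
        exact ⟨⟨by rw [Finset.card_insert_of_notMem hx, h1], h⟩, Finset.subset_insert _ _⟩
    rw [this, Finset.card_image_of_injOn]
    intro x hx y hy hxy
    have hx' : x ∉ S' := by simpa using (Finset.mem_filter.1 hx).2.1
    exact (Finset.insert_inj hx').1 hxy
  -- the outer door
  set O : Finset (T ⊕ ι) := (Finset.univ.erase i₀).image Sum.inr with hO
  have hOmem : ∀ j, Sum.inr j ∈ O ↔ j ≠ i₀ := by simp [hO]
  have hOinl : ∀ t, Sum.inl t ∉ O := by simp [hO]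
  have hOi : O.image c = Finset.univ.erase i₀ := by
    rw [hO, Finset.image_image]
    have : c ∘ Sum.inr = id := funext hc
    rw [this, Finset.image_id]
  have hOP : O ∈ P := by
    refine Finset.mem_filter.2 ⟨Finset.mem_univ _, ?_, ?_, hOi⟩
    · rw [hO, Finset.card_image_of_injective _ Sum.inr_injective,
        Finset.card_erase_add_one (Finset.mem_univ _), Finset.card_univ]
    · rintro (t | j)
      · refine ⟨i₀, fun x hx ↦ ?_⟩
        obtain ⟨j, hj, rfl⟩ := Finset.mem_image.1 hx
        exact (hlt i₀ j (by simpa using hj) t).le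
      · exact ⟨j, fun x _ ↦ hslack j x⟩
  have hOcard : (Finset.univ.filter fun x ↦ x ∉ O ∧ IsDominating r (insert x O)).card = 1 := by
    obtain ⟨t₀, -, ht₀⟩ := Finset.univ.exists_max_image (fun t ↦ r i₀ (Sum.inl t))
      (Finset.univ_nonempty (α := T))
    rw [Finset.card_eq_one]
    refine ⟨Sum.inl t₀, ?_⟩
    ext x
    simp only [Finset.mem_filter, Finset.mem_univ, true_and, Finset.mem_singleton]
    -- For `i ≠ i₀` the slack element of `i` belongs to `O` and is the strict bottom of ranking `i`,
    -- so no element of `T` lies below it.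
    have hbad : ∀ {x : T ⊕ ι} {t : T} {i : ι}, (∀ y ∈ insert x O, r i (.inl t) ≤ r i y) →
        i = i₀ := by
      intro x t i hi
      by_contra hne
      have := hi (.inr i) (Finset.mem_insert_of_mem ((hOmem i).2 hne))
      have h2 := hr i (this.antisymm (hslack i _))
      exact absurd h2 (by simp)
    constructor
    · rintro ⟨hxO, hd⟩
      obtain ⟨i, hi⟩ := hd (.inl t₀)
      obtain rfl := hbad hi
      have hx := hi x (by simp)
      rcases x with t | j
      · exact hr i (le_antisymm (ht₀ t (Finset.mem_univ _)) hx)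
      · have : j = i := by simpa [hOmem] using hxO
        subst this
        exact absurd (hr j (hx.antisymm (hslack j _))) (by simp)
    · rintro rfl
      refine ⟨hOinl _, ?_⟩
      rintro (t | j)
      · refine ⟨i₀, fun x hx ↦ ?_⟩
        rcases Finset.mem_insert.1 hx with rfl | hx
        · exact ht₀ t (Finset.mem_univ _)
        · obtain ⟨j, hj, rfl⟩ := Finset.mem_image.1 hx
          exact (hlt i₀ j (by simpa using hj) t).le
      · exact ⟨j, fun x _ ↦ hslack j x⟩
  have hinner : ∀ S' ∈ P.erase O, Even (R.bipartiteAbove (fun S' S ↦ S' ⊆ S) S').card := by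
    intro S' hS'
    obtain ⟨hne, hS'P⟩ := Finset.mem_erase.1 hS'
    obtain ⟨h1, h2, h3⟩ := (Finset.mem_filter.1 hS'P).2
    -- A door made of slack elements alone omits the slack of `i₀` by its colours, hence equals `O`
    -- by cardinality.
    obtain ⟨t, ht⟩ : ∃ t, Sum.inl t ∈ S' := by
      by_contra! hno
      refine hne (Finset.eq_of_subset_of_card_le ?_ ?_)
      · rintro (t | j) hx
        · exact absurd hx (hno t)
        · refine (hOmem j).2 ?_
          have := Finset.mem_image_of_mem c hx
          rw [h3, hc] at this
          exact Finset.ne_of_mem_erase this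
      · have := (Finset.mem_filter.1 hOP).2.1
        lia
    rw [hdoor S' hS'P, h2.card_filter_insert hr ⟨_, ht⟩ h1]
    · exact even_two
    · exact fun k ↦ ⟨.inr k, fun l hl ↦ ⟨_, ht, hlt l k hl.symm t⟩⟩
  have heven : Even (∑ S ∈ R, (P.bipartiteBelow (fun S' S ↦ S' ⊆ S) S).card) :=
    Finset.even_sum _ hroom
  rw [← hcount, ← Finset.add_sum_erase _ _ hOP, hdoor O hOP, hOcard] at heven
  have := Finset.even_sum _ hinner
  rw [Nat.even_add] at heven
  exact absurd (heven.2 this) (by simp)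

/-! ### Scarf's lemma on the integer grid. -/

/-- Combinatorial fixed point principle on the grid of `ℕ`-valued functions with sum `N`: for
every colouring there is a grid point `p` such that each colour `i` occurs near `p`, unless
the `i`-th coordinate of `p` is small. -/
lemma exists_grid_near_all_colors {ι : Type*} [Fintype ι] [Nonempty ι] (N : ℕ)
    (c : (ι → ℕ) → ι) :
    ∃ p : ι → ℕ, ∑ i, p i = N ∧ ∀ i, p i ≤ Fintype.card ι ∨
      ∃ q : ι → ℕ, ∑ i, q i = N ∧ c q = i ∧
        ∀ l, q l ≤ p l + Fintype.card ι ∧ p l ≤ q l + Fintype.card ι := by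
  classical
  set n := Fintype.card ι with hn
  let T := {x // x ∈ Finset.piAntidiag (Finset.univ : Finset ι) N}
  have hTsum : ∀ t : T, ∑ i, t.1 i = N := fun t ↦ (Finset.mem_piAntidiag.1 t.2).1
  have hTmk : ∀ x : ι → ℕ, ∑ i, x i = N → x ∈ Finset.piAntidiag (Finset.univ : Finset ι) N :=
    fun x hx ↦ Finset.mem_piAntidiag.2 ⟨hx, by simp⟩
  obtain ⟨j₀⟩ := ‹Nonempty ι›
  have : Nonempty ι := ⟨j₀⟩
  have : Nonempty T := ⟨⟨Pi.single j₀ N, hTmk _ (by simp)⟩⟩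
  let M := Fintype.card T
  let e : T ≃ Fin M := Fintype.equivFin T
  let q : ι ≃ Fin n := Fintype.equivFin ι
  -- Ranking `i` orders grid points by coordinate `i`, with ties broken by `e`. Its own slack is at
  -- the bottom and the other slacks are on top.
  let r : ι → T ⊕ ι → ℕ := fun i ↦
    Sum.elim (fun t ↦ 1 + (t.1 i * M + e t)) fun j ↦ if j = i then 0 else 1 + (N + 1) * M + q j
  have hlt : ∀ i j, j ≠ i → ∀ t, r i (.inl t) < r i (.inr j) := by
    intro i j hji t
    have h1 : t.1 i ≤ N :=
      (Finset.single_le_sum (fun _ _ ↦ Nat.zero_le _) (Finset.mem_univ i)).trans_eq (hTsum t)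
    have h2 : t.1 i * M ≤ N * M := Nat.mul_le_mul_right _ h1
    have h3 := (e t).2
    simp only [r, Sum.elim_inl, Sum.elim_inr, if_neg hji]
    lia
  have hr0 : ∀ i, r i (.inr i) = 0 := fun i ↦ by simp [r]
  have hinl : ∀ i t s, r i (.inl t) ≤ r i (.inl s) → t.1 i ≤ s.1 i := by
    intro i t s h
    by_contra! hcon
    have h1 : (s.1 i + 1) * M ≤ t.1 i * M := Nat.mul_le_mul_right _ hcon
    have h2 := (e s).2
    simp only [r, Sum.elim_inl] at h
    lia
  have hr : ∀ i, Function.Injective (r i) := by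
    rintro i (t | j) (s | k) h
    · have h1 := (hinl i t s h.le).antisymm (hinl i s t h.ge)
      simp only [r, Sum.elim_inl, h1] at h
      have : e t = e s := Fin.ext (by lia)
      rw [e.injective this]
    · by_cases hk : k = i
      · simp [r, hk] at h
      · exact absurd h (hlt i k hk t).ne
    · by_cases hj : j = i
      · simp only [r, Sum.elim_inl, Sum.elim_inr, if_pos hj] at h
        lia
      · exact absurd h (hlt i j hj s).ne'
    · simp only [r, Sum.elim_inr] at h
      split_ifs at h with h1 h2 h2
      · rw [h1, h2]
      · lia
      · lia
      · have : q j = q k := Fin.ext (by lia)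
        rw [q.injective this]
  obtain ⟨S, -, hSdom, hSc⟩ := exists_isDominating_image_eq_univ r hr
    (fun i v ↦ by rw [hr0]; exact Nat.zero_le _) hlt
    (Sum.elim (fun t ↦ c t.1) id) (fun i ↦ rfl)
  set A : Finset ι := Finset.univ.filter fun i ↦ Sum.inr i ∉ S with hA
  -- every colour in `A` is carried by a grid point of `S`
  have hcol : ∀ i ∈ A, ∃ t, Sum.inl t ∈ S ∧ c t.1 = i := by
    intro i hi
    have hiS : i ∈ S.image (Sum.elim (fun t : T ↦ c t.1) id) := by rw [hSc]; simp
    obtain ⟨v, hv, hvi⟩ := Finset.mem_image.1 hiS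
    rcases v with t | j
    · exact ⟨t, hv, hvi⟩
    · obtain rfl : j = i := hvi
      exact absurd hv (by simpa [hA] using hi)
  have hdom : ∀ y : ι → ℕ, ∑ i, y i = N → ∃ i ∈ A, ∀ t, Sum.inl t ∈ S → y i ≤ t.1 i := by
    intro y hy
    obtain ⟨i, hi⟩ := hSdom (.inl ⟨y, hTmk y hy⟩)
    refine ⟨i, ?_, fun t ht ↦ hinl i ⟨y, hTmk y hy⟩ t (hi _ ht)⟩
    simp only [hA, Finset.mem_filter, Finset.mem_univ, true_and]
    intro hiS
    have h := hi _ hiS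
    rw [hr0] at h
    simp [r] at h
  obtain ⟨i₁, hi₁, -⟩ := hdom (Pi.single j₀ N) (by simp)
  obtain ⟨p, hpS, -⟩ := hcol i₁ hi₁
  set σ : Finset T := Finset.univ.filter fun t ↦ Sum.inl t ∈ S with hσ
  have hσmem : ∀ t, t ∈ σ ↔ Sum.inl t ∈ S := by simp [hσ]
  choose m hmσ hm using fun i : ι ↦ σ.exists_min_image (fun t ↦ t.1 i) ⟨p, (hσmem p).2 hpS⟩
  -- Otherwise raising each minimum over `A` by one and placing the excess on `i₁` gives an
  -- undominated grid point. Hence the points of `S` exceed these minima by at most `n` on `A` and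
  -- have coordinates at most `n` off `A`.
  have hsum : N ≤ ∑ i ∈ A, (m i).1 i + n := by
    by_contra! hcon
    have hcard : A.card ≤ n := Finset.card_le_univ A
    have h1 : ∑ i ∈ A, ((m i).1 i + 1) ≤ N := by
      rw [Finset.sum_add_distrib, Finset.sum_const, smul_eq_mul, mul_one]
      lia
    obtain ⟨k, hk⟩ := Nat.exists_eq_add_of_le h1
    obtain ⟨i, hi, hle⟩ := hdom
      (fun i ↦ (if i ∈ A then (m i).1 i + 1 else 0) + (Pi.single i₁ k : ι → ℕ) i) (by
        rw [Finset.sum_add_distrib, Finset.sum_pi_single', ← Finset.sum_filter]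
        simp [hk])
    have := hle (m i) ((hσmem _).1 (hmσ i))
    rw [if_pos hi] at this
    lia
  have hin : ∀ i ∈ A, ∀ t, Sum.inl t ∈ S → t.1 i ≤ (m i).1 i + n := by
    intro i hi t ht
    have h1 : ∑ l ∈ A.erase i, (m l).1 l ≤ ∑ l ∈ A.erase i, t.1 l :=
      Finset.sum_le_sum fun l _ ↦ hm l t ((hσmem t).2 ht)
    have h2 : ∑ l ∈ A, t.1 l ≤ N :=
      (Finset.sum_le_univ_sum_of_nonneg fun _ ↦ Nat.zero_le _).trans_eq (hTsum t)
    rw [← Finset.add_sum_erase _ _ hi] at h2 hsum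
    lia
  have hnotin : ∀ i ∉ A, ∀ t, Sum.inl t ∈ S → t.1 i ≤ n := by
    intro i hi t ht
    have h1 : ∑ l ∈ A, (m l).1 l ≤ ∑ l ∈ A, t.1 l :=
      Finset.sum_le_sum fun l _ ↦ hm l t ((hσmem t).2 ht)
    have h2 : ∑ l ∈ insert i A, t.1 l ≤ N :=
      (Finset.sum_le_univ_sum_of_nonneg fun _ ↦ Nat.zero_le _).trans_eq (hTsum t)
    rw [Finset.sum_insert hi] at h2
    lia
  have hclose : ∀ t s, Sum.inl t ∈ S → Sum.inl s ∈ S → ∀ l, t.1 l ≤ s.1 l + n := by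
    intro t s ht hs l
    by_cases hl : l ∈ A
    · have := hin l hl t ht
      have := hm l s ((hσmem s).2 hs)
      lia
    · have := hnotin l hl t ht
      lia
  refine ⟨p.1, hTsum p, fun i ↦ ?_⟩
  by_cases hi : i ∈ A
  · obtain ⟨t, ht, hti⟩ := hcol i hi
    exact Or.inr ⟨t.1, hTsum t, hti, fun l ↦ ⟨hclose t p ht hpS l, hclose p t hpS ht l⟩⟩
  · exact Or.inl (hnotin i hi p hpS)

/-! ### Brouwer's theorem by approximation. -/

/-- **Brouwer's fixed point theorem** for the standard simplex. -/
theorem exists_fixedPoint_stdSimplex {ι : Type*} [Fintype ι] [Nonempty ι]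
    (φ : (ι → ℝ) → ι → ℝ) (hφ : ContinuousOn φ (stdSimplex ℝ ι))
    (hmaps : MapsTo φ (stdSimplex ℝ ι) (stdSimplex ℝ ι)) :
    ∃ x ∈ stdSimplex ℝ ι, φ x = x := by
  set n := Fintype.card ι with hn
  -- The colour of `x` is a coordinate that `φ` does not decrease; one exists because both
  -- coordinate sums are 1.
  have hcol : ∀ x : ι → ℝ, ∃ i, x ∈ stdSimplex ℝ ι → x i ≤ φ x i := by
    intro x
    by_cases hx : x ∈ stdSimplex ℝ ι
    · obtain ⟨i, -, hi⟩ := Finset.exists_le_of_sum_le (s := Finset.univ) (f := x) (g := φ x)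
        Finset.univ_nonempty (by rw [hx.2, (hmaps hx).2])
      exact ⟨i, fun _ ↦ hi⟩
    · exact ⟨Classical.arbitrary ι, fun h ↦ absurd h hx⟩
  choose c hc using hcol
  let sc : ℕ → (ι → ℕ) → ι → ℝ := fun N p i ↦ p i / (N + 1 : ℕ)
  have hsc : ∀ N p, ∑ i, p i = N + 1 → sc N p ∈ stdSimplex ℝ ι := by
    intro N p hp
    refine ⟨fun i ↦ by positivity, ?_⟩
    simp only [sc]
    rw [← Finset.sum_div, ← Nat.cast_sum, hp, div_self (by positivity)]
  have happrox : ∀ N : ℕ, ∃ x ∈ stdSimplex ℝ ι, ∀ i, ∃ y ∈ stdSimplex ℝ ι,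
      dist x y ≤ n / (N + 1 : ℕ) ∧ y i ≤ φ y i + n / (N + 1 : ℕ) := by
    intro N
    have hN : (0 : ℝ) < (N + 1 : ℕ) := by positivity
    obtain ⟨p, hp, h⟩ := exists_grid_near_all_colors (N + 1) fun p ↦ c (sc N p)
    refine ⟨sc N p, hsc N p hp, fun i ↦ ?_⟩
    rcases h i with h | ⟨q, hq, hqi, hpq⟩
    · refine ⟨sc N p, hsc N p hp, by rw [dist_self]; positivity, ?_⟩
      have h0 := (hmaps (hsc N p hp)).1 i
      have : sc N p i ≤ n / (N + 1 : ℕ) :=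
        div_le_div_of_nonneg_right (by exact_mod_cast h) hN.le
      linarith
    · refine ⟨sc N q, hsc N q hq, ?_, ?_⟩
      · rw [dist_pi_le_iff (by positivity)]
        intro l
        have h1 : (q l : ℝ) ≤ p l + n := by exact_mod_cast (hpq l).1
        have h2 : (p l : ℝ) ≤ q l + n := by exact_mod_cast (hpq l).2
        simp only [sc]
        rw [Real.dist_eq, ← sub_div, abs_div, abs_of_pos hN]
        refine div_le_div_of_nonneg_right (abs_le.2 ⟨?_, ?_⟩) hN.le <;> linarith
      · have := hc (sc N q) (hsc N q hq)
        simp only [hqi] at this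
        have : (0 : ℝ) ≤ n / (N + 1 : ℕ) := by positivity
        linarith
  choose x hx y hy hxy hyφ using happrox
  obtain ⟨a, ha, u, hu, hlim⟩ := (isCompact_stdSimplex ℝ ι).tendsto_subseq hx
  have hεlim : Filter.Tendsto (fun k ↦ (n : ℝ) / (u k + 1 : ℕ)) Filter.atTop (𝓝 0) :=
    ((tendsto_const_div_atTop_nhds_zero_nat (n : ℝ)).comp (Filter.tendsto_add_atTop_nat 1)).comp
      hu.tendsto_atTop
  -- The witnesses for every colour converge to the same limit `a`; equal coordinate sums then turn
  -- these inequalities into equalities.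
  have hle : ∀ i, a i ≤ φ a i := by
    intro i
    have hylim : Filter.Tendsto (fun k ↦ y (u k) i) Filter.atTop (𝓝 a) :=
      hlim.congr_dist (squeeze_zero (fun _ ↦ dist_nonneg) (fun k ↦ hxy (u k) i) hεlim)
    have hφlim : Filter.Tendsto (fun k ↦ φ (y (u k) i)) Filter.atTop (𝓝 (φ a)) :=
      (hφ a ha).tendsto.comp
        (tendsto_nhdsWithin_iff.2 ⟨hylim, Filter.Eventually.of_forall fun k ↦ hy (u k) i⟩)
    have h1 := (tendsto_pi_nhds.1 hylim) i
    have h2 := ((tendsto_pi_nhds.1 hφlim) i).add hεlim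
    rw [add_zero] at h2
    exact le_of_tendsto_of_tendsto' h1 h2 fun k ↦ hyφ (u k) i
  refine ⟨a, ha, funext fun i ↦ ?_⟩
  have := (Finset.sum_eq_sum_iff_of_le fun i _ ↦ hle i).1 (by rw [ha.2, (hmaps ha).2])
  exact (this i (Finset.mem_univ i)).symm

/-! ### KKM theorems. -/

/-- **Knaster–Kuratowski–Mazurkiewicz theorem** on the standard simplex. -/
theorem nonempty_iInter_of_forall_exists_pos_mem {ι : Type*} [Fintype ι] [Nonempty ι]
    (F : ι → Set (ι → ℝ)) (hF : ∀ i, IsClosed (F i))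
    (hcov : ∀ x ∈ stdSimplex ℝ ι, ∃ i, 0 < x i ∧ x ∈ F i) :
    ∃ x ∈ stdSimplex ℝ ι, ∀ i, x ∈ F i := by
  classical
  -- The distance to an empty set is 0 by convention, so nonemptiness is needed; the vertex `i` can
  -- only be covered by `F i`.
  have hne : ∀ i, (F i).Nonempty := by
    intro i
    obtain ⟨j, hj, hjF⟩ := hcov _ (single_mem_stdSimplex ℝ i)
    obtain rfl : j = i := by
      by_contra h
      simp [h] at hj
    exact ⟨_, hjF⟩
  let d : ι → (ι → ℝ) → ℝ := fun i x ↦ Metric.infDist x (F i)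
  have hd : ∀ i x, 0 ≤ d i x := fun i x ↦ Metric.infDist_nonneg
  have hdc : ∀ i, Continuous (d i) := fun i ↦ Metric.continuous_infDist_pt _
  have hs : ∀ x, 0 ≤ ∑ i, d i x := fun x ↦ Finset.sum_nonneg fun i _ ↦ hd i x
  obtain ⟨x, hx, hfix⟩ := exists_fixedPoint_stdSimplex
    (fun x i ↦ (x i + d i x) / (1 + ∑ j, d j x))
    (Continuous.continuousOn (continuous_pi fun i ↦
      ((continuous_apply i).add (hdc i)).div
        (continuous_const.add (continuous_finsetSum _ fun j _ ↦ hdc j))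
        fun x ↦ by have := hs x; positivity))
    (by
      intro x hx
      have := hs x
      refine ⟨fun i ↦ div_nonneg (add_nonneg (hx.1 i) (hd i x)) (by positivity), ?_⟩
      rw [← Finset.sum_div, Finset.sum_add_distrib, hx.2, div_self (by positivity)])
  -- At the fixed point, one positive coordinate with zero distance makes the total distance vanish.
  have heq : ∀ i, d i x = x i * ∑ j, d j x := by
    intro i
    have := hs x
    have h := congrFun hfix i
    rw [div_eq_iff (by positivity)] at h
    linarith
  obtain ⟨i, hi, hiF⟩ := hcov x hx
  have hzero : ∑ j, d j x = 0 := by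
    have h := heq i
    rw [show d i x = 0 from Metric.infDist_zero_of_mem hiF] at h
    exact (mul_eq_zero.1 h.symm).resolve_left hi.ne'
  refine ⟨x, hx, fun j ↦ ?_⟩
  rw [(hF j).mem_iff_infDist_zero (hne j)]
  exact (heq j).trans (by rw [hzero, mul_zero])

/-- **Fan–KKM theorem** for finite families in a topological vector space. -/
theorem nonempty_iInter_of_convexHull_subset {X : Type*} [AddCommGroup X] [Module ℝ X]
    [TopologicalSpace X] [ContinuousAdd X] [ContinuousSMul ℝ X] {s : Finset X}
    (hs : s.Nonempty) (G : X → Set X) (hG : ∀ y ∈ s, IsClosed (G y))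
    (hcov : ∀ t ⊆ s, convexHull ℝ (t : Set X) ⊆ ⋃ y ∈ t, G y) :
    ∃ x ∈ convexHull ℝ (s : Set X), ∀ y ∈ s, x ∈ G y := by
  classical
  have : Nonempty s := hs.to_subtype
  let g : (s → ℝ) → X := fun w ↦ ∑ y, w y • (y : X)
  have hg : Continuous g := continuous_finsetSum _ fun y _ ↦ (continuous_apply y).smul continuous_const
  obtain ⟨w, hw, hwG⟩ := nonempty_iInter_of_forall_exists_pos_mem (fun y : s ↦ g ⁻¹' G y)
    (fun y ↦ (hG y y.2).preimage hg) (by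
      intro w hw
      -- Covering the hull of the support of `w` yields an index of positive weight.
      let t : Finset s := Finset.univ.filter fun y ↦ 0 < w y
      have htmem : ∀ y, y ∈ t ↔ 0 < w y := by simp [t]
      have hz : ∀ y ∈ Finset.univ, y ∉ t → w y = 0 := fun y _ hy ↦
        le_antisymm (not_lt.1 fun h ↦ hy ((htmem y).2 h)) (hw.1 y)
      have hmem : g w ∈ convexHull ℝ ((t.image Subtype.val : Finset X) : Set X) := by
        have : g w = ∑ y ∈ t, w y • (y : X) :=
          (Finset.sum_subset (Finset.subset_univ t) fun y hy hyt ↦ by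
            rw [hz y hy hyt, zero_smul]).symm
        rw [this]
        refine (convex_convexHull ℝ _).sum_mem (fun y _ ↦ hw.1 y) ?_ fun y hy ↦
          subset_convexHull ℝ _ (by simpa using hy)
        rw [Finset.sum_subset (Finset.subset_univ t) hz, hw.2]
      have := hcov _ (fun x hx ↦ by
        obtain ⟨y, -, rfl⟩ := Finset.mem_image.1 hx
        exact y.2) hmem
      obtain ⟨y, hy, hyG⟩ := Set.mem_iUnion₂.1 this
      obtain ⟨y, hyt, rfl⟩ := Finset.mem_image.1 hy
      exact ⟨y, (htmem y).1 hyt, hyG⟩)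
  exact ⟨g w, (convex_convexHull ℝ _).sum_mem (fun y _ ↦ hw.1 y) hw.2
    fun y _ ↦ subset_convexHull ℝ _ y.2, fun y hy ↦ hwG ⟨y, hy⟩⟩

/-! ### Density in polytopes. -/

/-- The points of a self segment-dense set lying in a polytope spanned by such points are dense in
that polytope. -/
lemma SelfSegmentDense.convexHull_subset_closure {X : Type*} [AddCommGroup X] [Module ℝ X]
    [TopologicalSpace X] [ContinuousAdd X] [ContinuousConstSMul ℝ X] {D K : Set X}
    (hD : SelfSegmentDense D K) (s : Finset X) (hs : (s : Set X) ⊆ D) :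
    convexHull ℝ (s : Set X) ⊆ closure (convexHull ℝ (s : Set X) ∩ D) := by
  classical
  induction s using Finset.induction_on with
  | empty => simp
  | insert a s ha ih =>
    rw [Finset.coe_insert, Set.insert_subset_iff] at hs
    rcases s.eq_empty_or_nonempty with rfl | hne
    · rw [insert_empty_eq, Finset.coe_singleton, convexHull_singleton]
      rw [Set.inter_eq_left.2 (Set.singleton_subset_iff.2 hs.1)]
      exact subset_closure
    have hsub : convexHull ℝ (s : Set X) ⊆ convexHull ℝ (insert a s : Finset X) :=
      convexHull_mono (by simp)
    have haco : a ∈ convexHull ℝ ((insert a s : Finset X) : Set X) :=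
      subset_convexHull ℝ _ (by simp)
    intro z hz
    have hz' := hz
    rw [Finset.coe_insert, convexHull_insert (by simpa using hne), mem_convexJoin] at hz'
    obtain ⟨b, hb, v, hv, hzv⟩ := hz'
    obtain rfl : a = b := hb.symm
    obtain ⟨α, β, hα, hβ, hαβ, rfl⟩ := hzv
    -- Two approximations: first `v` by points of `D` in the smaller hull, then the point of the
    -- segment from `a` by points of `D`.
    rw [← closure_closure]
    refine map_mem_closure (f := fun v ↦ α • a + β • v)
      (continuous_const.add (continuous_const_smul β)) (ih hs.2 hv) ?_
    rintro v ⟨hvs, hvD⟩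
    exact closure_mono (Set.inter_subset_inter_left _
      ((convex_convexHull ℝ _).segment_subset haco (hsub hvs)))
      (hD.2.2 a hs.1 v hvD ⟨α, β, hα, hβ, hαβ, rfl⟩)

/-! ### Salient cones and strong upper semicontinuity. -/

section Cone

variable {Z : Type*} [AddCommGroup Z] [Module ℝ Z] {C : PointedCone ℝ Z}

/-- In a salient cone, the nonzero elements absorb addition of cone elements. -/
lemma PointedCone.add_mem_diff_zero (hC : (C : Set Z) ∩ -(C : Set Z) = {0}) {a b : Z}
    (ha : a ∈ (C : Set Z) \ {0}) (hb : b ∈ C) : a + b ∈ (C : Set Z) \ {0} := by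
  refine ⟨C.add_mem ha.1 hb, fun h ↦ ha.2 ?_⟩
  rw [← hC]
  refine ⟨ha.1, ?_⟩
  rw [Set.mem_neg, neg_eq_of_add_eq_zero_right h]
  exact hb

lemma PointedCone.mem_neg_diff_zero {z : Z} :
    z ∈ -(C : Set Z) \ {0} ↔ -z ∈ (C : Set Z) \ {0} := by
  simp

lemma PointedCone.sum_smul_mem_diff_zero (hC : (C : Set Z) ∩ -(C : Set Z) = {0}) {n : ℕ}
    {w : Fin n → ℝ} {z : Fin n → Z} (hw : ∀ i, 0 ≤ w i) (hw1 : ∑ i, w i = 1)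
    (hz : ∀ i, z i ∈ (C : Set Z) \ {0}) : ∑ i, w i • z i ∈ (C : Set Z) \ {0} := by
  obtain ⟨i, hi⟩ : ∃ i, 0 < w i := by
    by_contra! h
    have := Finset.sum_nonpos fun i (_ : i ∈ Finset.univ) ↦ h i
    linarith
  rw [← Finset.add_sum_erase _ _ (Finset.mem_univ i)]
  refine PointedCone.add_mem_diff_zero hC ⟨C.smul_mem (hw i) (hz i).1, ?_⟩
    (C.sum_mem fun j _ ↦ C.smul_mem (hw j) (hz j).1)
  simp only [Set.mem_singleton_iff, smul_eq_zero, hi.ne', false_or]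
  exact (hz i).2

/-- Strong upper semicontinuity propagates strict negativity to a neighbourhood. -/
lemma StronglyUpperSemicontinuousAt.exists_nhds_mem {X : Type*} [TopologicalSpace X] {K : Set X}
    {g : X → Z} {x : X} (h : StronglyUpperSemicontinuousAt C K g x)
    (hx : g x ∈ -(C : Set Z) \ {0}) : ∃ U ∈ 𝓝 x, ∀ u ∈ U ∩ K, g u ∈ -(C : Set Z) \ {0} := by
  -- The choice `k = -g x` turns `g x + k - (C \ {0})` into `-(C \ {0})`.
  obtain ⟨U, hU, h⟩ := h _ (PointedCone.mem_neg_diff_zero.1 hx)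
  refine ⟨U, hU, fun u hu ↦ ?_⟩
  obtain ⟨a, ha, b, hb, hab⟩ := h u hu
  have ha0 : a = 0 := by simpa using ha
  rw [PointedCone.mem_neg_diff_zero, ← hab, ha0]
  simpa using hb

end Cone

/-! ### The equilibrium theorem. -/

theorem theoremt21
    {X Z : Type*}
    [AddCommGroup X] [Module ℝ X] [TopologicalSpace X] [IsTopologicalAddGroup X]
    [ContinuousSMul ℝ X] [LocallyConvexSpace ℝ X] [T2Space X]
    [AddCommGroup Z] [Module ℝ Z] [TopologicalSpace Z] [IsTopologicalAddGroup Z]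
    [ContinuousSMul ℝ Z] [LocallyConvexSpace ℝ Z] [T2Space Z]
    -- `C` is a convex cone containing `0`, with `C ∩ (-C) = {0}`
    (C : PointedCone ℝ Z) (hC : (C : Set Z) ∩ -(C : Set Z) = {0})
    (K : Set X) (hKne : K.Nonempty) (hKconv : Convex ℝ K) (hKclosed : IsClosed K)
    (D : Set X) (hD : SelfSegmentDense D K)
    -- `f : K × K → Z`; only its values on `K × K` are used
    (f : X → X → Z)
    (h₁ : ∀ y ∈ D, ∀ x ∈ K, StronglyUpperSemicontinuousAt C K (fun x' => f x' y) x)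
    (h₂ : ∀ x ∈ K, ∀ y ∈ K \ D, StronglyUpperSemicontinuousAt C K (fun y' => f x y') y)
    (h₃ : ∀ x ∈ D, ConeConvexOn C D (fun y => f x y))
    (h₄ : ∀ x ∈ D, f x x ∉ (-(C : Set Z)) \ {0})
    (h₅ : ∃ K₀ : Set X, IsCompact K₀ ∧
      ∃ y₀ ∈ D, ∀ x ∈ K \ K₀, f x y₀ ∈ (-(C : Set Z)) \ {0}) :
    ∃ x₀ ∈ K, ∀ y ∈ K, f x₀ y ∉ (-(C : Set Z)) \ {0} := by
  classical
  obtain ⟨K₀, hK₀, y₀, hy₀, hcoer⟩ := h₅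
  let G : X → Set X := fun y ↦ {x ∈ K | f x y ∉ (-(C : Set Z)) \ {0}}
  have hGclosed : ∀ y ∈ D, IsClosed (G y) := by
    intro y hy
    rw [← closure_subset_iff_isClosed]
    intro x hx
    have hxK : x ∈ K := hKclosed.closure_subset (closure_mono (fun _ h ↦ h.1) hx)
    refine ⟨hxK, fun hneg ↦ ?_⟩
    obtain ⟨U, hU, hUneg⟩ := (h₁ y hy x hxK).exists_nhds_mem hneg
    obtain ⟨u, huU, huG⟩ := mem_closure_iff_nhds.1 hx U hU
    exact huG.2 (hUneg u ⟨huU, huG.1⟩)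
  have hcover : ∀ s : Finset X, (s : Set X) ⊆ D →
      convexHull ℝ (s : Set X) ∩ D ⊆ ⋃ y ∈ s, G y := by
    rintro s hs x ⟨hxs, hxD⟩
    by_contra hcon
    simp only [Set.mem_iUnion, not_exists] at hcon
    have hneg : ∀ y ∈ s, -f x y ∈ (C : Set Z) \ {0} := fun y hy ↦ by
      have := hcon y hy
      simp only [G, Set.mem_ofPred_eq, not_and, not_not] at this
      exact PointedCone.mem_neg_diff_zero.1 (this (hD.1 hxD))
    obtain ⟨w, hw0, hw1, hwx⟩ := Finset.mem_convexHull'.1 hxs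
    let e := s.equivFin.symm
    have hx : ∑ i, w (e i) • (e i : X) = x := by
      rw [e.sum_comp fun y : s ↦ w y • (y : X), Finset.sum_coe_sort s fun y ↦ w y • y, hwx]
    have hw1' : ∑ i, w (e i) = 1 := by
      rw [e.sum_comp fun y : s ↦ w y, Finset.sum_coe_sort s w, hw1]
    have hconv := h₃ x hxD _ (fun i ↦ (e i : X)) (fun i ↦ w (e i)) (fun i ↦ hs (e i).2)
      (fun i ↦ hw0 _ (e i).2) hw1' (by rw [hx]; exact hxD)
    rw [hx] at hconv
    have hpos := PointedCone.sum_smul_mem_diff_zero hC (fun i ↦ hw0 _ (e i).2) hw1'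
      fun i ↦ hneg _ (e i).2
    -- The weighted values `f x y` cancel, leaving `-f x x`.
    have := PointedCone.add_mem_diff_zero hC hpos hconv
    refine h₄ x hxD (PointedCone.mem_neg_diff_zero.2 ?_)
    simpa only [smul_neg, Finset.sum_neg_distrib, neg_add_eq_sub, sub_sub_cancel_left] using this
  have hcover' : ∀ s : Finset X, (s : Set X) ⊆ D →
      convexHull ℝ (s : Set X) ⊆ ⋃ y ∈ s, G y := by
    intro s hs
    refine (hD.convexHull_subset_closure s hs).trans (closure_minimal (hcover s hs) ?_)
    exact s.finite_toSet.isClosed_biUnion fun y hy ↦ hGclosed y (hs hy)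
  have hGcompact : IsCompact (G y₀) := hK₀.of_isClosed_subset (hGclosed y₀ hy₀) fun x hx ↦ by
    by_contra h
    exact hx.2 (hcoer x ⟨hx.1, h⟩)
  obtain ⟨x₀, hx₀, hx₀D⟩ := hGcompact.inter_iInter_nonempty (fun y : D ↦ G y)
    (fun y ↦ hGclosed y y.2) (by
      intro u
      -- Including `y₀` places the common point in the compact set `G y₀`.
      let s : Finset X := insert y₀ (u.image Subtype.val)
      have hs : (s : Set X) ⊆ D := by
        intro y hy
        rcases Finset.mem_insert.1 hy with rfl | hy
        · exact hy₀
        · obtain ⟨y, -, rfl⟩ := Finset.mem_image.1 hy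
          exact y.2
      obtain ⟨x, -, hx⟩ := nonempty_iInter_of_convexHull_subset (s := s)
        (Finset.insert_nonempty _ _) G (fun y hy ↦ hGclosed y (hs hy))
        fun t ht ↦ hcover' t ((Finset.coe_subset.2 ht).trans hs)
      exact ⟨x, hx _ (by simp [s]), Set.mem_iInter₂.2 fun y hy ↦
        hx _ (Finset.mem_insert_of_mem (Finset.mem_image_of_mem _ hy))⟩)
  refine ⟨x₀, hx₀.1, fun y hyK hneg ↦ ?_⟩
  have hD₀ : ∀ y ∈ D, f x₀ y ∉ (-(C : Set Z)) \ {0} := fun y hy ↦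
    (Set.mem_iInter.1 hx₀D ⟨y, hy⟩).2
  by_cases hyD : y ∈ D
  · exact hD₀ y hyD hneg
  · obtain ⟨U, hU, hUneg⟩ := (h₂ x₀ hx₀.1 y ⟨hyK, hyD⟩).exists_nhds_mem hneg
    obtain ⟨u, huU, huD⟩ := mem_closure_iff_nhds.1 (hD.2.1 hyK) U hU
    exact hD₀ u huD (hUneg u ⟨huU, hD.1 huD⟩)
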